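/- Let $E\subset\mathbb{R}^2$ be the spiral-type domain given in polar coordinates $(r,\theta)$ by $$E:=\Big\{(r\cos\theta,\,r\sin\theta):\ 2\pi\le\theta<\infty,\ \frac{1}{(\theta+\pi)\log^2(\theta+\pi)}\le r<\frac{1}{\theta\log^2\theta}\Big\},$$ where $\log$ is the natural logarithm. Then the characteristic function $\mathbf{1}_E$ belongs to the Besov space $B^{1/p}_{p,\infty}(\mathbb{R}^2)$ for every $p\in[1,\infty]$ (with $1/\infty:=0$). Here, for $s\in\mathbb{R}$ and $p\in(0,\infty]$, $B^{s}_{p,\infty}(\mathbb{R}^n)$ is the space of all $f\in\mathcal{S}'(\mathbb{R}^n)$ with $$\sup_{j\in\mathbb{N}_0}2^{js}\,\|\varphi_j*f\|_{L^p(\mathbb{R}^n)}<\infty,$$ where $\varphi_j:=2^{jn}\varphi(2^j\cdot)$ for $j\ge1$ and $\varphi_0,\varphi\in\mathcal{S}(\mathbb{R}^n)$ have real-valued nonnegative Fourier transforms $\mathcal{F}\varphi_0,\mathcal{F}\varphi$ (with $\mathcal{F}\psi(\xi)=(2\pi)^{-n/2}\int_{\mathbb{R}^n}e^{-ix\cdot\xi}\psi(x)\,dx$)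 such that, for some constant $C>0$, $\operatorname{supp}\mathcal{F}\varphi_0\subset\{|\xi|\le2\}$ and $\mathcal{F}\varphi_0\ge C$ on $\{|\xi|\le\frac53\}$, while $\operatorname{supp}\mathcal{F}\varphi\subset\{\frac12\le|\xi|\le2\}$ and $\mathcal{F}\varphi\ge C$ on $\{\frac35\le|\xi|\le\frac53\}$. The assertion holds for every such pair $(\varphi_0,\varphi)$. -/

import Mathlib

open MeasureTheory SchwartzMap
open scoped ENNReal

noncomputable section

namespace SpiralBesov

/-- `ℝⁿ` with its Euclidean norm. -/
abbrev Rn (n : ℕ) : Type := EuclideanSpace ℝ (Fin n)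

/-- The Fourier transform `(2π)^{-n/2} ∫ e^{-i x·ξ} φ(x) dx`. -/
def fourierT {n : ℕ} (φ : 𝓢(Rn n, ℂ)) (ξ : Rn n) : ℂ :=
  (((2 * Real.pi) ^ (-(n : ℝ) / 2) : ℝ) : ℂ) *
    ∫ x : Rn n, Complex.exp (-Complex.I * ((inner ℝ x ξ : ℝ) : ℂ)) * φ x

/-- Admissible pairs `(φ₀, φ)` generating a dyadic resolution in frequency: the Fourier transforms
are real-valued and nonnegative, are supported in `{|ξ| ≤ 2}` and `{1/2 ≤ |ξ| ≤ 2}`, and are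
bounded below by a positive constant on `{|ξ| ≤ 5/3}` and `{3/5 ≤ |ξ| ≤ 5/3}`, respectively. -/
structure IsAdmissible {n : ℕ} (φ₀ φ : 𝓢(Rn n, ℂ)) : Prop where
  im_zero : ∀ ξ, (fourierT φ₀ ξ).im = 0
  im : ∀ ξ, (fourierT φ ξ).im = 0
  nonneg_zero : ∀ ξ, 0 ≤ (fourierT φ₀ ξ).re
  nonneg : ∀ ξ, 0 ≤ (fourierT φ ξ).re
  supp_zero : tsupport (fourierT φ₀) ⊆ {ξ | ‖ξ‖ ≤ 2}
  supp : tsupport (fourierT φ) ⊆ {ξ | 1 / 2 ≤ ‖ξ‖ ∧ ‖ξ‖ ≤ 2}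
  lower : ∃ C : ℝ, 0 < C ∧ (∀ ξ, ‖ξ‖ ≤ 5 / 3 → C ≤ ‖fourierT φ₀ ξ‖) ∧
    ∀ ξ, 3 / 5 ≤ ‖ξ‖ → ‖ξ‖ ≤ 5 / 3 → C ≤ ‖fourierT φ ξ‖

/-- The rescaled Schwartz function `x ↦ 2^{jn} φ(2^j x)`. -/
def dilate {n : ℕ} (φ : 𝓢(Rn n, ℂ)) (j : ℕ) : 𝓢(Rn n, ℂ) :=
  ((2 : ℂ) ^ (j * n)) • SchwartzMap.compCLMOfContinuousLinearEquiv ℂ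
    (ContinuousLinearEquiv.smulLeft (Units.mk0 ((2 : ℝ) ^ j) (by positivity)) :
      Rn n ≃L[ℝ] Rn n) φ

/-- The sequence `φ₀, φ₁, φ₂, …` with `φ_j = 2^{jn} φ(2^j ·)` for `j ≥ 1`. -/
def resolution {n : ℕ} (φ₀ φ : 𝓢(Rn n, ℂ)) (j : ℕ) : 𝓢(Rn n, ℂ) :=
  if j = 0 then φ₀ else dilate φ j

/-- The Schwartz function `y ↦ φ(x - y)`. -/
def reflectAt {n : ℕ} (φ : 𝓢(Rn n, ℂ)) (x : Rn n) : 𝓢(Rn n, ℂ) :=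
  SchwartzMap.compSubConstCLM ℂ x
    (SchwartzMap.compCLMOfContinuousLinearEquiv ℂ (ContinuousLinearEquiv.neg ℝ) φ)

/-- The convolution `φ ∗ f` of a Schwartz function with a tempered distribution, as a function. -/
def conv {n : ℕ} (φ : 𝓢(Rn n, ℂ)) (f : 𝓢'(Rn n, ℂ)) (x : Rn n) : ℂ :=
  f (reflectAt φ x)

/-- The Besov (quasi-)norm `‖f‖_{B^s_{p,q}(ℝⁿ)}` of a tempered distribution with respect to the
pair `(φ₀, φ)`, for `p, q ∈ (0, ∞]`. -/
def besovNorm {n : ℕ} (φ₀ φ : 𝓢(Rn n, ℂ)) (s : ℝ) (p q : ℝ≥0∞) (f : 𝓢'(Rn n, ℂ)) : ℝ≥0∞ :=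
  if q = ∞ then
    ⨆ j : ℕ, ENNReal.ofReal (2 ^ (j * s)) * eLpNorm (conv (resolution φ₀ φ j) f) p volume
  else
    (∑' j : ℕ, (ENNReal.ofReal (2 ^ (j * s)) *
      eLpNorm (conv (resolution φ₀ φ j) f) p volume) ^ q.toReal) ^ (1 / q.toReal)

/-- The Besov space `B^s_{p,q}(ℝⁿ)`, defined by means of the pair `(φ₀, φ)`. -/
def besovSpace {n : ℕ} (φ₀ φ : 𝓢(Rn n, ℂ)) (s : ℝ) (p q : ℝ≥0∞) : Set 𝓢'(Rn n, ℂ) :=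
  {f | besovNorm φ₀ φ s p q f < ∞}

/-- The tempered distribution `T` is the regular distribution given by the function `g`. -/
def IsRegularDistribution {n : ℕ} (T : 𝓢'(Rn n, ℂ)) (g : Rn n → ℂ) : Prop :=
  ∀ ψ : 𝓢(Rn n, ℂ), Integrable (fun x => g x * ψ x) ∧ T ψ = ∫ x, g x * ψ x

/-- The spiral-type domain, in polar coordinates `(r, θ)`:
`1 / ((θ + π) log² (θ + π)) ≤ r < 1 / (θ log² θ)`, `2π ≤ θ < ∞`. -/
def spiralDomain : Set (Rn 2) :=
  {x | ∃ r θ : ℝ, 2 * Real.pi ≤ θ ∧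
    1 / ((θ + Real.pi) * Real.log (θ + Real.pi) ^ 2) ≤ r ∧
    r < 1 / (θ * Real.log θ ^ 2) ∧
    x = !₂[r * Real.cos θ, r * Real.sin θ]}

/-! The pointwise formulas, and existence of admissible pairs. -/

theorem resolution_apply {n : ℕ} (φ₀ φ : 𝓢(Rn n, ℂ)) (j : ℕ) (hj : j ≠ 0) (x : Rn n) :
    resolution φ₀ φ j x = 2 ^ (j * n) * φ ((2 : ℝ) ^ j • x) := by
  simp [resolution, hj, dilate]

theorem reflectAt_apply {n : ℕ} (φ : 𝓢(Rn n, ℂ)) (x y : Rn n) :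
    reflectAt φ x y = φ (x - y) := by
  simp [reflectAt]

theorem fourierT_eq {n : ℕ} (φ : 𝓢(Rn n, ℂ)) (ξ : Rn n) :
    fourierT φ ξ = (((2 * Real.pi) ^ (-(n : ℝ) / 2) : ℝ) : ℂ) *
      FourierTransform.fourier φ ((2 * Real.pi)⁻¹ • ξ) := by
  rw [fourierT, SchwartzMap.fourier_coe, Real.fourier_eq']
  congr 1
  refine integral_congr_ae (Filter.Eventually.of_forall fun x => ?_)
  simp only [smul_eq_mul, inner_smul_right]
  congr 2
  have : (Real.pi : ℂ) ≠ 0 := by exact_mod_cast Real.pi_ne_zero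
  push_cast
  field_simp

theorem exists_fourierT_eq {n : ℕ} (g : Rn n → ℝ) (hg : ContDiff ℝ (⊤ : ℕ∞) g)
    (hc : HasCompactSupport g) :
    ∃ φ : 𝓢(Rn n, ℂ), ∀ ξ, fourierT φ ξ = ((g ξ : ℝ) : ℂ) := by
  have hpi : (2 * Real.pi) ≠ 0 := by positivity
  set c : ℝ := (2 * Real.pi) ^ (-(n : ℝ) / 2) with hcdef
  have hc0 : (c : ℂ) ≠ 0 := by
    have : 0 < c := by positivity
    exact_mod_cast this.ne'
  let G : Rn n → ℂ := fun η => (c : ℂ)⁻¹ * ((g ((2 * Real.pi) • η) : ℝ) : ℂ)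
  have hG : ContDiff ℝ (⊤ : ℕ∞) G :=
    contDiff_const.mul (Complex.ofRealCLM.contDiff.comp (hg.comp (contDiff_const_smul _)))
  have hGc : HasCompactSupport G := by
    have h1 : HasCompactSupport (fun η : Rn n => g ((2 * Real.pi) • η)) :=
      hc.comp_homeomorph (Homeomorph.smulOfNeZero (2 * Real.pi) hpi)
    exact (h1.comp_left (g := fun t : ℝ => (t : ℂ)) (by simp)).mul_left
  refine ⟨FourierTransformInv.fourierInv (hGc.toSchwartzMap hG), fun ξ => ?_⟩
  rw [fourierT_eq, FourierTransform.fourier_fourierInv_eq]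
  change (c : ℂ) * ((c : ℂ)⁻¹ * ((g ((2 * Real.pi) • (2 * Real.pi)⁻¹ • ξ) : ℝ) : ℂ)) = _
  rw [smul_inv_smul₀ hpi, mul_inv_cancel_left₀ hc0]

theorem exists_isAdmissible (n : ℕ) : ∃ φ₀ φ : 𝓢(Rn n, ℂ), IsAdmissible φ₀ φ := by
  let b : ContDiffBump (0 : Rn n) := ⟨5 / 3, 2, by norm_num, by norm_num⟩
  let a : ContDiffBump (0 : Rn n) := ⟨1 / 2, 3 / 5, by norm_num, by norm_num⟩
  obtain ⟨φ₀, h₀⟩ := exists_fourierT_eq (fun ξ => b ξ) b.contDiff b.hasCompactSupport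
  obtain ⟨φ, h⟩ := exists_fourierT_eq (fun ξ => b ξ * (1 - a ξ))
    (b.contDiff.mul (contDiff_const.sub a.contDiff)) b.hasCompactSupport.mul_right
  have hb1 : ∀ ξ : Rn n, ‖ξ‖ ≤ 5 / 3 → b ξ = 1 := fun ξ hξ =>
    b.one_of_mem_closedBall (by simpa using hξ)
  have hb0 : ∀ ξ : Rn n, 2 < ‖ξ‖ → b ξ = 0 := fun ξ hξ =>
    b.zero_of_le_dist (by simpa using hξ.le)
  have ha1 : ∀ ξ : Rn n, ‖ξ‖ ≤ 1 / 2 → a ξ = 1 := fun ξ hξ =>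
    a.one_of_mem_closedBall (mem_closedBall_zero_iff.2 hξ)
  have ha0 : ∀ ξ : Rn n, 3 / 5 ≤ ‖ξ‖ → a ξ = 0 := fun ξ hξ =>
    a.zero_of_le_dist (by simpa using hξ)
  refine ⟨φ₀, φ, ⟨?_, ?_, ?_, ?_, ?_, ?_, 1, one_pos, ?_, ?_⟩⟩
  · intro ξ
    simp [h₀]
  · intro ξ
    rw [h]
    exact Complex.ofReal_im _
  · intro ξ
    rw [h₀, Complex.ofReal_re]
    exact b.nonneg
  · intro ξ
    rw [h, Complex.ofReal_re]
    exact mul_nonneg b.nonneg (sub_nonneg.2 a.le_one)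
  · refine closure_minimal (fun ξ hξ => ?_) (isClosed_le continuous_norm continuous_const)
    by_contra hlt
    exact hξ (by rw [h₀, hb0 ξ (not_le.1 hlt), Complex.ofReal_zero])
  · refine closure_minimal (fun ξ hξ => ?_)
      ((isClosed_le continuous_const continuous_norm).inter
        (isClosed_le continuous_norm continuous_const))
    constructor
    · by_contra hlt
      exact hξ (by rw [h, ha1 ξ (not_le.1 hlt).le]; simp)
    · by_contra hlt
      exact hξ (by rw [h, hb0 ξ (not_le.1 hlt)]; simp)
  · intro ξ hξ
    simp [h₀, hb1 ξ hξ]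
  · intro ξ h1 h2
    rw [h, hb1 ξ h2, ha0 ξ h1]
    simp

end SpiralBesov

end

noncomputable section

namespace SpiralBesov

/-! The boundary of `E` lies on two congruent spirals and a segment. The spirals have finite length
because `1 / (θ log² θ)` is integrable at infinity, with antiderivative `-1 / log θ`. A
`δ`-neighbourhood of the boundary therefore has area `O(δ)`. If exactly one of `x`, `x - y` lies in
the closure `S` of `E`, the segment joining them meets the boundary, so `S` and its translate by `y`
differ in area `O(|y|)` (`volume_translate_le`).

For `j ≥ 1` the kernel `φ_j` has mean zero, so `φ_j * 1_S (x) = ∫ φ_j(z) (1_S(x - z) - 1_S(x)) dz`.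
Its `L¹` norm is at most a constant times `∫ |φ_j(z)| |z| dz = O(2⁻ʲ)`, and its sup norm is at most
`‖φ‖₁`. Then `‖g‖_p ^ p ≤ ‖g‖_∞ ^ (p - 1) ‖g‖₁` gives `O(2^(-j/p))`
(`setDistribution_mem_besovSpace`). The boundary is null, so `1_E` and `1_S` define the same
distribution. -/

/-! ### Neighbourhoods of curves of finite length -/

/-- The `δ`-neighbourhood of a curve of length at most `L` in the plane has area
`O(L δ + δ ^ 2)`. -/
theorem volume_neighborhood_le {ι : Type*} (γ : ι → Rn 2) (F : ι → ℝ) {L : ℝ}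
    (hF : ∀ i, F i ∈ Set.Icc 0 L) (h : ∀ i j, dist (γ i) (γ j) ≤ |F i - F j|)
    {δ : ℝ} (hδ : 0 < δ) (hL : 0 ≤ L) :
    volume {x | ∃ i, dist x (γ i) ≤ δ} ≤
      ENNReal.ofReal (4 * (L * δ + δ ^ 2)) * volume (Metric.ball (0 : Rn 2) 1) := by
  set v := volume (Metric.ball (0 : Rn 2) 1)
  -- Cut the curve into about `L / δ` pieces on which `F` varies by at most `δ`. Each piece has
  -- diameter at most `δ`, so its `δ`-neighbourhood fits in one ball of radius `2δ`.
  let A : ℕ → Set (Rn 2) := fun k => {x | ∃ i, ⌊F i / δ⌋₊ = k ∧ dist x (γ i) ≤ δ}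
  have hA : ∀ k, volume (A k) ≤ ENNReal.ofReal ((2 * δ) ^ 2) * v := by
    intro k
    by_cases hk : ∃ i, ⌊F i / δ⌋₊ = k
    · obtain ⟨i, hi⟩ := hk
      have hsub : A k ⊆ Metric.closedBall (γ i) (2 * δ) := by
        rintro x ⟨j, hj, hx⟩
        have h1 := Nat.floor_le (div_nonneg (hF i).1 hδ.le)
        have h2 := Nat.lt_floor_add_one (F i / δ)
        have h3 := Nat.floor_le (div_nonneg (hF j).1 hδ.le)
        have h4 := Nat.lt_floor_add_one (F j / δ)
        rw [hi] at h1 h2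
        rw [hj] at h3 h4
        rw [le_div_iff₀ hδ] at h1 h3
        rw [div_lt_iff₀ hδ] at h2 h4
        have h5 : |F j - F i| ≤ δ := by
          rw [abs_le]
          constructor <;> linarith
        have := dist_triangle x (γ j) (γ i)
        have := h j i
        rw [Metric.mem_closedBall]
        linarith
      refine (measure_mono hsub).trans ?_
      rw [Measure.addHaar_closedBall _ _ (by positivity)]
      simp [v]
    · have : A k = ∅ := by
        ext x
        simp only [A, Set.mem_ofPred_eq, Set.mem_empty_iff_false, iff_false]
        rintro ⟨i, hi, -⟩
        exact hk ⟨i, hi⟩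
      simp [this]
  have hcov : {x | ∃ i, dist x (γ i) ≤ δ} ⊆ ⋃ k ∈ Finset.range (⌊L / δ⌋₊ + 1), A k := by
    rintro x ⟨i, hi⟩
    simp only [Set.mem_iUnion, Finset.mem_range]
    refine ⟨⌊F i / δ⌋₊, Nat.lt_succ_of_le (Nat.floor_mono ?_), i, rfl, hi⟩
    gcongr
    exact (hF i).2
  calc volume {x | ∃ i, dist x (γ i) ≤ δ}
      ≤ ∑ k ∈ Finset.range (⌊L / δ⌋₊ + 1), volume (A k) :=
        (measure_mono hcov).trans (measure_biUnion_finset_le _ _)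
    _ ≤ ∑ k ∈ Finset.range (⌊L / δ⌋₊ + 1), ENNReal.ofReal ((2 * δ) ^ 2) * v :=
        Finset.sum_le_sum fun k _ => hA k
    _ = ENNReal.ofReal ((⌊L / δ⌋₊ + 1 : ℕ) * (2 * δ) ^ 2) * v := by
        rw [ENNReal.ofReal_mul (by positivity), ENNReal.ofReal_natCast]
        simp [mul_assoc]
    _ ≤ _ := by
        refine mul_le_mul_left (ENNReal.ofReal_le_ofReal ?_) _
        have h1 := Nat.floor_le (div_nonneg hL hδ.le)
        rw [le_div_iff₀ hδ] at h1
        push_cast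
        nlinarith

/-! ### The spiral -/

/-- The radius `1 / (θ log² θ)`. -/
def radius (θ : ℝ) : ℝ := 1 / (θ * Real.log θ ^ 2)

/-- The spiral `θ ↦ e^{iθ} / (θ log² θ)`. -/
def spiral (θ : ℝ) : ℂ := radius θ * Complex.exp (θ * Complex.I)

/-- A decreasing function dominating the length of the remaining part of the spiral. -/
def remainingLength (θ : ℝ) : ℝ := radius θ + 1 / Real.log θ

theorem one_lt_log_of_two_pi_le {θ : ℝ} (h : 2 * Real.pi ≤ θ) : 1 < Real.log θ := by
  have h3 := Real.pi_gt_three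
  rw [Real.lt_log_iff_exp_lt (by linarith)]
  have := Real.exp_one_lt_d9
  linarith

theorem radius_pos {θ : ℝ} (h : 2 * Real.pi ≤ θ) : 0 < radius θ := by
  have := one_lt_log_of_two_pi_le h
  have : 0 < θ := by linarith [Real.pi_gt_three]
  unfold radius
  positivity

theorem radius_le_inv {θ : ℝ} (h : 2 * Real.pi ≤ θ) : radius θ ≤ 1 / θ := by
  have h1 := one_lt_log_of_two_pi_le h
  have : 0 < θ := by linarith [Real.pi_gt_three]
  exact one_div_le_one_div_of_le this (le_mul_of_one_le_right this.le (one_le_pow₀ h1.le))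

theorem radius_le_one {θ : ℝ} (h : 2 * Real.pi ≤ θ) : radius θ ≤ 1 := by
  refine (radius_le_inv h).trans ?_
  rw [div_le_one] <;> linarith [Real.pi_gt_three]

theorem remainingLength_mem {θ : ℝ} (h : 2 * Real.pi ≤ θ) :
    remainingLength θ ∈ Set.Icc (0 : ℝ) 2 := by
  have h1 := one_lt_log_of_two_pi_le h
  have h2 := radius_pos h
  have h3 := radius_le_one h
  have h4 : 1 / Real.log θ ≤ 1 := by rw [div_le_one] <;> linarith
  have h5 : 0 < 1 / Real.log θ := by positivity
  unfold remainingLength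
  constructor <;> linarith

/-- Only the sign of the derivative is needed: it turns the radial speed `|radius'|` into
`-radius'`. -/
theorem exists_hasDerivAt_radius {θ : ℝ} (h : 2 * Real.pi ≤ θ) :
    ∃ d ≤ 0, HasDerivAt radius d θ := by
  have h1 := one_lt_log_of_two_pi_le h
  have h0 : 0 < θ := by linarith [Real.pi_gt_three]
  have hd := ((hasDerivAt_id θ).mul ((Real.hasDerivAt_log h0.ne').pow 2)).inv
    (by simp only [Pi.mul_apply, Pi.pow_apply, id]; positivity)
  refine ⟨_, ?_, hd.congr_of_eventuallyEq (Filter.Eventually.of_forall fun x => ?_)⟩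
  · simp only [Pi.mul_apply, Pi.pow_apply, id]
    rw [neg_div, neg_nonpos]
    have : 0 < Real.log θ := by linarith
    positivity
  · simp [radius]

theorem continuousOn_radius : ContinuousOn radius (Set.Ici (2 * Real.pi)) := fun _ hθ =>
  (exists_hasDerivAt_radius hθ).choose_spec.2.continuousAt.continuousWithinAt

theorem hasDerivAt_inv_log {θ : ℝ} (h : 2 * Real.pi ≤ θ) :
    HasDerivAt (fun t => 1 / Real.log t) (-radius θ) θ := by
  have h1 := one_lt_log_of_two_pi_le h
  have h0 : 0 < θ := by linarith [Real.pi_gt_three]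
  have hl : Real.log θ ≠ 0 := by linarith
  refine (((Real.hasDerivAt_log h0.ne').inv hl).congr_deriv ?_).congr_of_eventuallyEq
    (Filter.Eventually.of_forall fun t => by simp)
  unfold radius
  field_simp

/-- The speed of the spiral is at most `-radius' + radius`, which is exactly `-remainingLength'`;
comparing derivatives replaces any computation of arc length. -/
theorem dist_spiral_le_sub {a b : ℝ} (ha : 2 * Real.pi ≤ a) (hab : a ≤ b) :
    ‖spiral b - spiral a‖ ≤ remainingLength a - remainingLength b := by
  choose! d hd using fun t (ht : 2 * Real.pi ≤ t) => exists_hasDerivAt_radius ht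
  have hs : ∀ t, 2 * Real.pi ≤ t → HasDerivAt spiral
      ((d t : ℂ) * Complex.exp (t * Complex.I) +
        radius t * (Complex.exp (t * Complex.I) * (1 * Complex.I))) t := by
    intro t ht
    exact (hd t ht).2.ofReal_comp.mul
      (((hasDerivAt_id t).ofReal_comp.mul_const Complex.I).cexp)
  have hF : ∀ t, 2 * Real.pi ≤ t → HasDerivAt remainingLength (d t + -radius t) t :=
    fun t ht => (hd t ht).2.add (hasDerivAt_inv_log ht)
  have key := image_norm_le_of_norm_deriv_right_le_deriv_boundary'
    (f := fun t => spiral t - spiral a) (a := a) (b := b)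
    (B := fun t => remainingLength a - remainingLength t)
    (fun t ht => ((hs t (ha.trans ht.1)).sub_const _).continuousAt.continuousWithinAt)
    (fun t ht => ((hs t (ha.trans ht.1)).sub_const _).hasDerivWithinAt) (by simp)
    (fun t ht => ((hF t (ha.trans ht.1)).const_sub _).continuousAt.continuousWithinAt)
    (fun t ht => ((hF t (ha.trans ht.1)).const_sub _).hasDerivWithinAt) ?_
    (Set.right_mem_Icc.2 hab)
  · exact key
  · intro t ht
    have ht' := ha.trans ht.1
    refine (norm_add_le _ _).trans ?_
    simp only [norm_mul, Complex.norm_exp_ofReal_mul_I, Complex.norm_real, Complex.norm_I,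
      Real.norm_eq_abs, abs_of_nonpos (hd t ht').1, abs_of_pos (radius_pos ht'), norm_one]
    linarith

theorem dist_spiral_le {a b : ℝ} (ha : 2 * Real.pi ≤ a) (hb : 2 * Real.pi ≤ b) :
    dist (spiral a) (spiral b) ≤ |remainingLength a - remainingLength b| := by
  rcases le_total a b with hab | hab
  · rw [dist_comm, dist_eq_norm]
    exact (dist_spiral_le_sub ha hab).trans (le_abs_self _)
  · rw [dist_eq_norm, abs_sub_comm]
    exact (dist_spiral_le_sub hb hab).trans (le_abs_self _)

theorem radius_anti {a b : ℝ} (ha : 2 * Real.pi ≤ a) (hab : a ≤ b) : radius b ≤ radius a := by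
  have h0 : 0 < a := by linarith [Real.pi_gt_three]
  have h1 := one_lt_log_of_two_pi_le ha
  have h2 := Real.log_le_log h0 hab
  exact one_div_le_one_div_of_le (by positivity) (by gcongr; linarith)

/-! ### Topological boundary of the spiral region -/

/-- The spiral-type domain in the complex plane. -/
def spiralRegion : Set ℂ :=
  {z | ∃ r θ : ℝ, 2 * Real.pi ≤ θ ∧ radius (θ + Real.pi) ≤ r ∧ r < radius θ ∧
    z = r * Complex.exp (θ * Complex.I)}

/-- The curves bounding the spiral-type domain: two spirals and a segment. -/
def spiralBoundary : Set ℂ :=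
  spiral '' Set.Ici (2 * Real.pi) ∪ (fun θ => -spiral θ) '' Set.Ici (2 * Real.pi) ∪
    (fun t : ℝ => (t : ℂ)) '' Set.Icc 0 1

/-- The origin is on the segment. Near any other point only a bounded range of `θ` matters, so
limits stay in the image of a compact parameter rectangle, and all the rectangle adds to the region
is the outer edge. -/
theorem closure_spiralRegion_subset : closure spiralRegion ⊆ spiralRegion ∪ spiralBoundary := by
  intro z hz
  by_cases h0 : z = 0
  · exact Or.inr (Or.inr ⟨0, by simp, by simp [h0]⟩)
  have hn : 0 < ‖z‖ := norm_pos_iff.2 h0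
  -- Points `w` near `z` have `‖z‖ / 2 < ‖w‖ < radius θ ≤ 1 / θ`, which forces `θ ≤ M`.
  set M := 2 / ‖z‖
  let Q : ℝ × ℝ → ℂ := fun q => ((radius (q.1 + Real.pi) * (1 - q.2) + radius q.1 * q.2 : ℝ) : ℂ) *
    Complex.exp (q.1 * Complex.I)
  have hpi := Real.pi_pos
  have hQ : ContinuousOn Q (Set.Icc (2 * Real.pi) M ×ˢ Set.Icc 0 1) := by
    have h1 : ContinuousOn (fun q : ℝ × ℝ => radius q.1)
        (Set.Icc (2 * Real.pi) M ×ˢ Set.Icc 0 1) :=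
      continuousOn_radius.comp (by fun_prop) (fun q hq => hq.1.1)
    have h2 : ContinuousOn (fun q : ℝ × ℝ => radius (q.1 + Real.pi))
        (Set.Icc (2 * Real.pi) M ×ˢ Set.Icc 0 1) :=
      continuousOn_radius.comp (f := fun q : ℝ × ℝ => q.1 + Real.pi) (by fun_prop)
        (fun q hq => by have := hq.1.1; simp only [Set.mem_Ici]; linarith)
    refine ContinuousOn.mul (Complex.continuous_ofReal.comp_continuousOn ?_) (by fun_prop)
    exact (h2.mul (by fun_prop)).add (h1.mul (by fun_prop))
  have hK : IsClosed (Q '' (Set.Icc (2 * Real.pi) M ×ˢ Set.Icc 0 1)) :=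
    ((isCompact_Icc.prod isCompact_Icc).image_of_continuousOn hQ).isClosed
  have hzK : z ∈ Q '' (Set.Icc (2 * Real.pi) M ×ˢ Set.Icc 0 1) := by
    rw [← hK.closure_eq]
    have hev : ∀ᶠ w in nhds z, ‖z‖ / 2 < ‖w‖ :=
      continuous_norm.continuousAt.eventually (lt_mem_nhds (by linarith))
    refine mem_closure_iff_frequently.2
      (((mem_closure_iff_frequently.1 hz).and_eventually hev).mono ?_)
    rintro w ⟨⟨r, θ, hθ, h1, h2, rfl⟩, hw⟩
    have hA := radius_pos (θ := θ + Real.pi) (by linarith)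
    have hr : 0 < r := hA.trans_le h1
    have hθ0 : 0 < θ := by linarith
    rw [norm_mul, Complex.norm_exp_ofReal_mul_I, mul_one, Complex.norm_real, Real.norm_eq_abs,
      abs_of_pos hr] at hw
    have h3 := radius_le_inv hθ
    have h4 : ‖z‖ / 2 < 1 / θ := by linarith
    have h5 : θ ≤ M := by
      rw [lt_div_iff₀ hθ0] at h4
      rw [le_div_iff₀ hn]
      nlinarith
    have hBA : 0 < radius θ - radius (θ + Real.pi) := by linarith
    refine ⟨(θ, (r - radius (θ + Real.pi)) / (radius θ - radius (θ + Real.pi))),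
      ⟨⟨hθ, h5⟩, div_nonneg (by linarith) hBA.le, (div_le_one hBA).2 (by linarith)⟩, ?_⟩
    simp only [Q]
    congr 2
    field_simp
    ring
  obtain ⟨⟨θ, s⟩, ⟨⟨hθ, -⟩, hs0, hs1⟩, rfl⟩ := hzK
  simp only at hθ hs0 hs1
  have hanti := radius_anti hθ (by linarith : θ ≤ θ + Real.pi)
  rcases eq_or_ne (radius (θ + Real.pi) * (1 - s) + radius θ * s) (radius θ) with h | h
  · refine Or.inr (Or.inl (Or.inl ⟨θ, hθ, ?_⟩))
    simp only [Q, h, spiral]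
  · exact Or.inl ⟨_, θ, hθ, by nlinarith, lt_of_le_of_ne (by nlinarith) h, rfl⟩

/-- Off the boundary curves all defining inequalities are strict: `θ = 2π` lies on the segment, and
the inner edge is the negated spiral at `θ + π`. A continuous local branch of the angle keeps them
strict nearby. -/
theorem mem_interior_spiralRegion {z : ℂ} (hz : z ∈ spiralRegion) (hb : z ∉ spiralBoundary) :
    z ∈ interior spiralRegion := by
  obtain ⟨r, θ, hθ, h1, h2, rfl⟩ := hz
  have hpi := Real.pi_pos
  have hA := radius_pos (θ := θ + Real.pi) (by linarith)
  have hr : 0 < r := hA.trans_le h1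
  have hθ' : 2 * Real.pi < θ := by
    refine lt_of_le_of_ne hθ fun h => hb (Or.inr ⟨r, ⟨hr.le, ?_⟩, ?_⟩)
    · linarith [radius_le_one hθ]
    · rw [← h]
      push_cast
      rw [Complex.exp_two_pi_mul_I, mul_one]
  have h1' : radius (θ + Real.pi) < r := by
    refine lt_of_le_of_ne h1 fun h => hb (Or.inl (Or.inr ⟨θ + Real.pi, ?_, ?_⟩))
    · simp only [Set.mem_Ici]; linarith
    · simp only [spiral, h]
      push_cast
      rw [add_mul, Complex.exp_add, Complex.exp_pi_mul_I]
      ring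
  set z : ℂ := r * Complex.exp (θ * Complex.I) with hzdef
  have hz0 : z ≠ 0 := mul_ne_zero (by exact_mod_cast hr.ne') (Complex.exp_ne_zero _)
  have hzn : ‖z‖ = r := by
    rw [hzdef, norm_mul, Complex.norm_exp_ofReal_mul_I, mul_one, Complex.norm_real,
      Real.norm_eq_abs, abs_of_pos hr]
  -- Dividing by `z` moves the base point to `1`, away from the branch cut of `arg`, and adding `θ`
  -- selects the correct turn of the spiral.
  let f : ℂ → ℝ := fun w => θ + Complex.arg (w / z)
  have hfz : f z = θ := by simp [f, hz0]
  have hf : ContinuousAt f z := by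
    refine continuousAt_const.add (ContinuousAt.comp (g := Complex.arg) ?_ (by fun_prop))
    rw [div_self hz0]
    exact Complex.continuousAt_arg Complex.one_mem_slitPlane
  have hc : ∀ t, 2 * Real.pi ≤ t → ContinuousAt radius t := fun t ht =>
    (exists_hasDerivAt_radius ht).choose_spec.2.continuousAt
  have hc1 : ContinuousAt (fun w => radius (f w)) z :=
    ContinuousAt.comp (g := radius) (by rw [hfz]; exact hc _ hθ) hf
  have hc2 : ContinuousAt (fun w => radius (f w + Real.pi)) z :=
    ContinuousAt.comp (g := radius) (f := fun w => f w + Real.pi)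
      (by rw [hfz]; exact hc _ (by linarith)) (hf.add continuousAt_const)
  have hc3 : ContinuousAt (fun w : ℂ => ‖w‖) z := continuous_norm.continuousAt
  rw [mem_interior_iff_mem_nhds]
  filter_upwards [hf.eventually_const_lt (by rw [hfz]; exact hθ'),
    hc2.eventually_lt hc3 (by rw [hfz, hzn]; exact h1'),
    hc3.eventually_lt hc1 (by rw [hfz, hzn]; exact h2)] with w w1 w2 w3
  refine ⟨‖w‖, f w, w1.le, w2.le, w3, ?_⟩
  have hrc : (r : ℂ) ≠ 0 := by exact_mod_cast hr.ne'
  have e1 := Complex.norm_mul_exp_arg_mul_I (w / z)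
  rw [norm_div, hzn] at e1
  simp only [f]
  push_cast
  rw [add_mul, Complex.exp_add]
  generalize Complex.arg (w / z) = α at e1
  rw [eq_div_iff hz0, hzdef] at e1
  refine e1.symm.trans ?_
  push_cast
  field_simp

theorem frontier_spiralRegion_subset : frontier spiralRegion ⊆ spiralBoundary := by
  intro z hz
  by_contra hb
  exact hz.2 (mem_interior_spiralRegion ((closure_spiralRegion_subset hz.1).resolve_right hb) hb)

/-! ### Transfer to `ℝ²` and area near the boundary -/

/-- The isometry identifying the complex plane with `ℝ²`. -/
abbrev planeIso : ℂ ≃ₗᵢ[ℝ] Rn 2 := Complex.orthonormalBasisOneI.repr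

theorem spiralDomain_eq_image : spiralDomain = planeIso '' spiralRegion := by
  have key : ∀ r θ : ℝ, planeIso (r * Complex.exp (θ * Complex.I)) =
      !₂[r * Real.cos θ, r * Real.sin θ] := by
    intro r θ
    refine WithLp.ofLp_injective _ ?_
    rw [Complex.orthonormalBasisOneI_repr_apply]
    simp [Complex.exp_ofReal_mul_I_re, Complex.exp_ofReal_mul_I_im]
  ext x
  constructor
  · rintro ⟨r, θ, h, h1, h2, rfl⟩
    exact ⟨_, ⟨r, θ, h, h1, h2, rfl⟩, key r θ⟩
  · rintro ⟨_, ⟨r, θ, h, h1, h2, rfl⟩, rfl⟩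
    exact ⟨r, θ, h, h1, h2, key r θ⟩

theorem frontier_spiralDomain_subset : frontier spiralDomain ⊆ planeIso '' spiralBoundary := by
  rw [spiralDomain_eq_image, ← planeIso.coe_toHomeomorph, ← Homeomorph.image_frontier]
  exact Set.image_mono frontier_spiralRegion_subset

theorem spiralDomain_subset_closedBall : spiralDomain ⊆ Metric.closedBall 0 1 := by
  rw [spiralDomain_eq_image]
  rintro _ ⟨_, ⟨r, θ, h, h1, h2, rfl⟩, rfl⟩
  have hA := radius_pos (θ := θ + Real.pi) (by linarith [Real.pi_pos])
  rw [mem_closedBall_zero_iff, LinearIsometryEquiv.norm_map, norm_mul,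
    Complex.norm_exp_ofReal_mul_I, mul_one, Complex.norm_real, Real.norm_eq_abs,
    abs_of_pos (hA.trans_le h1)]
  exact h2.le.trans (radius_le_one h)

theorem volume_neighborhood_spiralBoundary_le {δ : ℝ} (hδ : 0 < δ) (hδ1 : δ ≤ 1) :
    volume {x | ∃ z ∈ spiralBoundary, dist x (planeIso z) ≤ δ} ≤
      ENNReal.ofReal (36 * δ) * volume (Metric.ball (0 : Rn 2) 1) := by
  set v := volume (Metric.ball (0 : Rn 2) 1)
  -- With `L = 2` and `δ ≤ 1`, `4 (2δ + δ²) ≤ 12δ`; the three curves together give `36δ`.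
  have hb : ∀ {ι : Type} (γ : ι → ℂ) (F : ι → ℝ), (∀ i, F i ∈ Set.Icc 0 2) →
      (∀ i j, dist (γ i) (γ j) ≤ |F i - F j|) →
      volume {x | ∃ i, dist x (planeIso (γ i)) ≤ δ} ≤ ENNReal.ofReal (12 * δ) * v := by
    intro ι γ F hF h
    refine (volume_neighborhood_le (fun i => planeIso (γ i)) F hF (fun i j => ?_) hδ
      zero_le_two).trans ?_
    · rw [LinearIsometryEquiv.dist_map]
      exact h i j
    · exact mul_le_mul_left (ENNReal.ofReal_le_ofReal (by nlinarith)) _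
  have b1 := hb (ι := Set.Ici (2 * Real.pi)) (fun θ => spiral θ) (fun θ => remainingLength θ)
    (fun i => remainingLength_mem i.2) (fun i j => dist_spiral_le i.2 j.2)
  have b2 := hb (ι := Set.Ici (2 * Real.pi)) (fun θ => -spiral θ) (fun θ => remainingLength θ)
    (fun i => remainingLength_mem i.2) (fun i j => by
      rw [dist_neg_neg]; exact dist_spiral_le i.2 j.2)
  have b3 := hb (ι := Set.Icc (0 : ℝ) 1) (fun t => ((t : ℝ) : ℂ)) (fun t => t)
    (fun i => ⟨i.2.1, i.2.2.trans one_le_two⟩) (fun i j => by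
      rw [Complex.dist_eq, ← Complex.ofReal_sub, Complex.norm_real, Real.norm_eq_abs])
  have hsplit : ENNReal.ofReal (36 * δ) * v = ENNReal.ofReal (12 * δ) * v +
      ENNReal.ofReal (12 * δ) * v + ENNReal.ofReal (12 * δ) * v := by
    rw [← add_mul, ← add_mul, ← ENNReal.ofReal_add (by positivity) (by positivity),
      ← ENNReal.ofReal_add (by positivity) (by positivity)]
    ring_nf
  rw [hsplit]
  refine le_trans (measure_mono ?_)
    ((measure_union_le _ _).trans (add_le_add ((measure_union_le _ _).trans (add_le_add b1 b2)) b3))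
  rintro x ⟨z, (⟨θ, hθ, rfl⟩ | ⟨θ, hθ, rfl⟩) | ⟨t, ht, rfl⟩, hx⟩
  · exact Or.inl (Or.inl ⟨⟨θ, hθ⟩, hx⟩)
  · exact Or.inl (Or.inr ⟨⟨θ, hθ⟩, hx⟩)
  · exact Or.inr ⟨⟨t, ht⟩, hx⟩

theorem volume_frontier_spiralDomain : volume (frontier spiralDomain) = 0 := by
  have hv : volume (Metric.ball (0 : Rn 2) 1) ≠ ∞ := measure_ball_lt_top.ne
  have hlim : Filter.Tendsto (fun δ : ℝ => ENNReal.ofReal (36 * δ) *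
      volume (Metric.ball (0 : Rn 2) 1)) (nhdsWithin 0 (Set.Ioi 0)) (nhds 0) := by
    have : Filter.Tendsto (fun δ : ℝ => ENNReal.ofReal (36 * δ))
        (nhdsWithin 0 (Set.Ioi 0)) (nhds 0) := by
      have hc : Continuous fun δ : ℝ => ENNReal.ofReal (36 * δ) :=
        ENNReal.continuous_ofReal.comp (continuous_const_mul 36)
      simpa using (hc.tendsto 0).mono_left nhdsWithin_le_nhds
    simpa using ENNReal.Tendsto.mul_const this (Or.inr hv)
  refine le_antisymm (ge_of_tendsto hlim ?_) zero_le
  filter_upwards [Ioc_mem_nhdsGT (zero_lt_one (α := ℝ))] with δ hδ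
  refine le_trans (measure_mono fun x hx => ?_) (volume_neighborhood_spiralBoundary_le hδ.1 hδ.2)
  obtain ⟨z, hz, rfl⟩ := frontier_spiralDomain_subset hx
  exact ⟨z, hz, by simpa using hδ.1.le⟩

/-! ### Area change under translation -/

/-- Otherwise the interior of `A` and the complement of its closure would disconnect `s`. -/
theorem exists_mem_frontier_of_isPreconnected {X : Type*} [TopologicalSpace X] {s A : Set X}
    (hs : IsPreconnected s) {x y : X} (hx : x ∈ s) (hxA : x ∈ A) (hy : y ∈ s) (hyA : y ∉ A) :
    ∃ z ∈ s, z ∈ frontier A := by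
  by_contra! hcon
  have hin : ∀ z ∈ s, z ∈ closure A → z ∈ interior A := fun z hz hzc => by
    by_contra h
    exact hcon z hz ⟨hzc, h⟩
  obtain ⟨z, -, hz1, hz2⟩ := hs (interior A) (closure A)ᶜ isOpen_interior
    isClosed_closure.isOpen_compl
    (fun z hz => by
      by_cases h : z ∈ closure A
      · exact Or.inl (hin z hz h)
      · exact Or.inr h)
    ⟨x, hx, hin x hx (subset_closure hxA)⟩
    ⟨y, hy, fun h => hyA (interior_subset (hin y hy h))⟩
  exact hz2 (subset_closure (interior_subset hz1))

/-- The closure of the spiral-type domain and its translates differ by sets of area `O(|y|)`. -/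
theorem volume_translate_le (y : Rn 2) :
    volume {x | ¬(x ∈ closure spiralDomain ↔ x - y ∈ closure spiralDomain)} ≤
      ENNReal.ofReal (36 * ‖y‖) * volume (Metric.ball (0 : Rn 2) 1) := by
  rcases eq_or_ne y 0 with rfl | hy
  · simp
  have hy0 : 0 < ‖y‖ := norm_pos_iff.2 hy
  rcases le_or_gt ‖y‖ 1 with h1 | h1
  · refine le_trans (measure_mono fun x hx => ?_) (volume_neighborhood_spiralBoundary_le hy0 h1)
    have hseg : ∃ w ∈ segment ℝ x (x - y), w ∈ frontier (closure spiralDomain) := by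
      have hpre := (convex_segment x (x - y) (𝕜 := ℝ)).isPreconnected
      by_cases hxs : x ∈ closure spiralDomain
      · exact exists_mem_frontier_of_isPreconnected hpre (left_mem_segment ℝ _ _) hxs
          (right_mem_segment ℝ _ _) (fun h => hx (iff_of_true hxs h))
      · exact exists_mem_frontier_of_isPreconnected hpre (right_mem_segment ℝ _ _)
          (by by_contra h; exact hx (iff_of_false hxs h)) (left_mem_segment ℝ _ _) hxs
    obtain ⟨w, hw, hwf⟩ := hseg
    obtain ⟨z, hz, rfl⟩ := frontier_spiralDomain_subset (frontier_closure_subset hwf)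
    refine ⟨z, hz, ?_⟩
    have hball : segment ℝ x (x - y) ⊆ Metric.closedBall x ‖y‖ :=
      (convex_closedBall x ‖y‖).segment_subset (by simp) (by simp)
    simpa [dist_comm] using hball hw
  -- For `‖y‖ > 1` the neighbourhood bound is unavailable, but two unit balls already contain the
  -- set, and `2 ≤ 36 ‖y‖`.
  · have hS : closure spiralDomain ⊆ Metric.closedBall 0 1 :=
      closure_minimal spiralDomain_subset_closedBall Metric.isClosed_closedBall
    have hsub : {x | ¬(x ∈ closure spiralDomain ↔ x - y ∈ closure spiralDomain)} ⊆
        Metric.closedBall 0 1 ∪ Metric.closedBall y 1 := by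
      intro x hx
      by_cases hxs : x ∈ closure spiralDomain
      · exact Or.inl (hS hxs)
      · have : x - y ∈ closure spiralDomain := by by_contra h; exact hx (iff_of_false hxs h)
        refine Or.inr ?_
        simpa [dist_eq_norm] using hS this
    refine (measure_mono hsub).trans ((measure_union_le _ _).trans ?_)
    rw [Measure.addHaar_closedBall _ _ zero_le_one, Measure.addHaar_closedBall _ _ zero_le_one,
      ← add_mul, ← ENNReal.ofReal_add (by positivity) (by positivity)]
    refine mul_le_mul_left (ENNReal.ofReal_le_ofReal ?_) _
    simp only [one_pow]
    linarith

/-! ### Convolution with characteristic functions -/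

theorem lintegral_comp_smul_of_pos {n : ℕ} (f : Rn n → ℝ≥0∞) (hf : Measurable f) {R : ℝ}
    (hR : 0 < R) :
    ∫⁻ x, f (R • x) = ENNReal.ofReal ((R ^ n)⁻¹) * ∫⁻ x, f x := by
  rw [← lintegral_map (μ := volume) (g := fun x : Rn n => R • x) hf (measurable_const_smul R),
    Measure.map_addHaar_smul _ hR.ne', lintegral_smul_measure]
  simp [abs_of_pos hR]

theorem enorm_dilate {n : ℕ} (φ : 𝓢(Rn n, ℂ)) (j : ℕ) (x : Rn n) :
    ‖dilate φ j x‖ₑ = ENNReal.ofReal (((2 : ℝ) ^ j) ^ n) * ‖φ ((2 : ℝ) ^ j • x)‖ₑ := by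
  have : dilate φ j x = 2 ^ (j * n) * φ ((2 : ℝ) ^ j • x) := by simp [dilate]
  rw [this, enorm_mul]
  congr 1
  rw [← ofReal_norm]
  simp [pow_mul]

theorem lintegral_enorm_dilate {n : ℕ} (φ : 𝓢(Rn n, ℂ)) (j : ℕ) :
    ∫⁻ x, ‖dilate φ j x‖ₑ = ∫⁻ x, ‖φ x‖ₑ := by
  have hm : Measurable fun x => ‖φ x‖ₑ := φ.continuous.enorm.measurable
  simp_rw [enorm_dilate]
  rw [lintegral_const_mul' _ _ ENNReal.ofReal_ne_top,
    lintegral_comp_smul_of_pos _ hm (by positivity), ← mul_assoc,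
    ← ENNReal.ofReal_mul (by positivity), mul_inv_cancel₀ (by positivity), ENNReal.ofReal_one,
    one_mul]

/-- The first moment scales like `2⁻ʲ`; this is the only source of decay in `j`. -/
theorem lintegral_enorm_dilate_mul_enorm {n : ℕ} (φ : 𝓢(Rn n, ℂ)) (j : ℕ) :
    ENNReal.ofReal (2 ^ j) * ∫⁻ x, ‖dilate φ j x‖ₑ * ‖x‖ₑ = ∫⁻ x, ‖φ x‖ₑ * ‖x‖ₑ := by
  have hm : Measurable fun x => ‖φ x‖ₑ * ‖x‖ₑ := by
    exact φ.continuous.enorm.measurable.mul measurable_enorm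
  have hm' : Measurable fun x => ‖dilate φ j x‖ₑ * ‖x‖ₑ := by
    exact (dilate φ j).continuous.enorm.measurable.mul measurable_enorm
  rw [← lintegral_const_mul _ hm']
  have : ∀ x, ENNReal.ofReal (2 ^ j) * (‖dilate φ j x‖ₑ * ‖x‖ₑ) =
      ENNReal.ofReal (((2 : ℝ) ^ j) ^ n) *
        (‖φ ((2 : ℝ) ^ j • x)‖ₑ * ‖(2 : ℝ) ^ j • x‖ₑ) := by
    intro x
    rw [enorm_dilate, enorm_smul, Real.enorm_eq_ofReal (by positivity)]
    ring
  simp_rw [this]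
  rw [lintegral_const_mul' _ _ ENNReal.ofReal_ne_top,
    lintegral_comp_smul_of_pos (fun x => ‖φ x‖ₑ * ‖x‖ₑ) hm (by positivity), ← mul_assoc,
    ← ENNReal.ofReal_mul (by positivity), mul_inv_cancel₀ (by positivity), ENNReal.ofReal_one,
    one_mul]

theorem integral_dilate_eq_zero {n : ℕ} {φ : 𝓢(Rn n, ℂ)} (hφ : ∫ x, φ x = 0) (j : ℕ) :
    ∫ x, dilate φ j x = 0 := by
  have : ∀ x, dilate φ j x = 2 ^ (j * n) * φ ((2 : ℝ) ^ j • x) := by simp [dilate]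
  simp_rw [this]
  rw [integral_const_mul, Measure.integral_comp_smul volume (fun x => φ x), hφ]
  simp

/-- The integral is a multiple of the Fourier transform at `0`, a point outside the annulus carrying
the support. -/
theorem IsAdmissible.integral_eq_zero {n : ℕ} {φ₀ φ : 𝓢(Rn n, ℂ)} (h : IsAdmissible φ₀ φ) :
    ∫ x, φ x = 0 := by
  have h0 : fourierT φ 0 = 0 := by
    by_contra hne
    have := (h.supp (subset_tsupport _ hne)).1
    norm_num at this
  rw [fourierT, mul_eq_zero] at h0
  rcases h0 with h0 | h0
  · exact absurd h0 (by
      have : 0 < (2 * Real.pi) ^ (-(n : ℝ) / 2) := by positivity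
      exact_mod_cast this.ne')
  · simpa using h0

theorem lintegral_enorm_lt_top {n : ℕ} (φ : 𝓢(Rn n, ℂ)) : ∫⁻ x, ‖φ x‖ₑ < ∞ :=
  φ.integrable.2

theorem lintegral_enorm_mul_enorm_lt_top {n : ℕ} (φ : 𝓢(Rn n, ℂ)) :
    ∫⁻ x, ‖φ x‖ₑ * ‖x‖ₑ < ∞ := by
  have h := (φ.integrable_pow_mul volume 1).2
  refine lt_of_le_of_lt (lintegral_mono fun x => ?_) h
  simp [enorm_mul, mul_comm]

/-- The tempered distribution `ψ ↦ ∫_S ψ`, for `S` of finite measure. -/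
def setDistribution {n : ℕ} (S : Set (Rn n)) (hS : volume S < ∞) : 𝓢'(Rn n, ℂ) :=
  haveI : IsFiniteMeasure (volume.restrict S) := isFiniteMeasure_restrict.2 hS.ne
  (volume.restrict S).toTemperedDistribution

theorem setDistribution_apply {n : ℕ} (S : Set (Rn n)) (hS : volume S < ∞) (ψ : 𝓢(Rn n, ℂ)) :
    setDistribution S hS ψ = ∫ x in S, ψ x := rfl

theorem conv_setDistribution {n : ℕ} {S : Set (Rn n)} (hm : MeasurableSet S)
    (hS : volume S < ∞) (ψ : 𝓢(Rn n, ℂ)) (x : Rn n) :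
    conv ψ (setDistribution S hS) x = ∫ z, {z | x - z ∈ S}.indicator ψ z := by
  rw [conv, setDistribution_apply, ← integral_indicator hm,
    ← integral_sub_left_eq_self _ volume x]
  refine integral_congr_ae (Filter.Eventually.of_forall fun z => ?_)
  simp only [Set.indicator, reflectAt_apply, sub_sub_cancel]
  rfl

theorem enorm_conv_le {n : ℕ} {S : Set (Rn n)} (hm : MeasurableSet S)
    (hS : volume S < ∞) (ψ : 𝓢(Rn n, ℂ)) (x : Rn n) :
    ‖conv ψ (setDistribution S hS) x‖ₑ ≤ ∫⁻ z, {z | x - z ∈ S}.indicator (fun z => ‖ψ z‖ₑ) z := by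
  rw [conv_setDistribution hm]
  refine (enorm_integral_le_lintegral_enorm _).trans (lintegral_mono fun z => ?_)
  rw [enorm_indicator_eq_indicator_enorm]

/-- Mean zero allows subtracting the constant `1_S(x)`, so only those `z` count for which passing
from `x` to `x - z` changes membership in `S`. -/
theorem enorm_conv_le_of_integral_eq_zero {n : ℕ} {S : Set (Rn n)} (hm : MeasurableSet S)
    (hS : volume S < ∞) {ψ : 𝓢(Rn n, ℂ)} (hψ : ∫ z, ψ z = 0) (x : Rn n) :
    ‖conv ψ (setDistribution S hS) x‖ₑ ≤
      ∫⁻ z, {z | ¬(x ∈ S ↔ x - z ∈ S)}.indicator (fun z => ‖ψ z‖ₑ) z := by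
  have hm' : MeasurableSet {z | x - z ∈ S} := (measurable_const.sub measurable_id) hm
  rw [conv_setDistribution hm]
  by_cases hx : x ∈ S
  · have h1 : ∫ z, {z | x - z ∈ S}.indicator ψ z = -∫ z, {z | x - z ∈ S}ᶜ.indicator ψ z := by
      rw [integral_indicator hm', integral_indicator hm'.compl, eq_neg_iff_add_eq_zero,
        integral_add_compl hm' ψ.integrable, hψ]
    rw [h1, enorm_neg]
    refine (enorm_integral_le_lintegral_enorm _).trans (lintegral_mono fun z => ?_)
    rw [enorm_indicator_eq_indicator_enorm]
    refine le_of_eq (congrFun (congrArg (fun A => Set.indicator A fun z => ‖ψ z‖ₑ) ?_) z)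
    ext z
    simp [hx]
  · refine (enorm_integral_le_lintegral_enorm _).trans (lintegral_mono fun z => ?_)
    rw [enorm_indicator_eq_indicator_enorm]
    refine le_of_eq (congrFun (congrArg (fun A => Set.indicator A fun z => ‖ψ z‖ₑ) ?_) z)
    ext z
    simp [hx]

/-- Tonelli: integrating in `x` first leaves the measure of the slice at `z`. -/
theorem lintegral_lintegral_indicator_le {n : ℕ} (W : Set (Rn n × Rn n)) (hW : MeasurableSet W)
    (ψ : 𝓢(Rn n, ℂ)) (b : Rn n → ℝ≥0∞) (hb : ∀ z, volume {x | (x, z) ∈ W} ≤ b z) :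
    ∫⁻ x, ∫⁻ z, {z | (x, z) ∈ W}.indicator (fun z => ‖ψ z‖ₑ) z ≤ ∫⁻ z, ‖ψ z‖ₑ * b z := by
  have hmeas : Measurable (Function.uncurry fun x z : Rn n =>
      {z | (x, z) ∈ W}.indicator (fun z => ‖ψ z‖ₑ) z) := by
    have : (Function.uncurry fun x z : Rn n => {z | (x, z) ∈ W}.indicator (fun z => ‖ψ z‖ₑ) z) =
        W.indicator (fun q => ‖ψ q.2‖ₑ) := by
      ext ⟨x, z⟩
      simp [Set.indicator]
    rw [this]
    exact (ψ.continuous.enorm.measurable.comp measurable_snd).indicator hW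
  rw [lintegral_lintegral_swap hmeas.aemeasurable]
  refine lintegral_mono fun z => ?_
  have h2 : ∀ x, {z | (x, z) ∈ W}.indicator (fun z => ‖ψ z‖ₑ) z =
      {x | (x, z) ∈ W}.indicator (fun _ => ‖ψ z‖ₑ) x := fun x => by simp [Set.indicator]
  simp_rw [h2]
  have hz : MeasurableSet {x | (x, z) ∈ W} := measurable_prodMk_right hW
  rw [lintegral_indicator_const hz]
  gcongr
  exact hb z

theorem lintegral_enorm_conv_le {n : ℕ} {S : Set (Rn n)} (hm : MeasurableSet S)
    (hS : volume S < ∞) (ψ : 𝓢(Rn n, ℂ)) :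
    ∫⁻ x, ‖conv ψ (setDistribution S hS) x‖ₑ ≤ volume S * ∫⁻ z, ‖ψ z‖ₑ := by
  refine (lintegral_mono fun x => enorm_conv_le hm hS ψ x).trans ?_
  refine (lintegral_lintegral_indicator_le {q | q.1 - q.2 ∈ S}
    ((measurable_fst.sub measurable_snd) hm) ψ (fun _ => volume S) fun z => ?_).trans ?_
  · have := measure_preimage_add_right volume (-z) S
    simp only [← sub_eq_add_neg] at this
    exact this.le
  · rw [lintegral_mul_const _ ψ.continuous.enorm.measurable, mul_comm]

theorem lintegral_enorm_conv_le_of_integral_eq_zero {n : ℕ} {S : Set (Rn n)}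
    (hm : MeasurableSet S) (hS : volume S < ∞) {K : ℝ≥0∞}
    (hK : ∀ y, volume {x | ¬(x ∈ S ↔ x - y ∈ S)} ≤ K * ‖y‖ₑ)
    {ψ : 𝓢(Rn n, ℂ)} (hψ : ∫ z, ψ z = 0) :
    ∫⁻ x, ‖conv ψ (setDistribution S hS) x‖ₑ ≤ K * ∫⁻ z, ‖ψ z‖ₑ * ‖z‖ₑ := by
  refine (lintegral_mono fun x => enorm_conv_le_of_integral_eq_zero hm hS hψ x).trans ?_
  refine (lintegral_lintegral_indicator_le {q | ¬(q.1 ∈ S ↔ q.1 - q.2 ∈ S)}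
    (MeasurableSet.compl ((measurable_fst hm).iff ((measurable_fst.sub measurable_snd) hm)))
    ψ _ hK).trans ?_
  have hmm : Measurable fun z => ‖ψ z‖ₑ * ‖z‖ₑ :=
    ψ.continuous.enorm.measurable.mul measurable_enorm
  rw [← lintegral_const_mul _ hmm]
  refine lintegral_mono fun z => le_of_eq ?_
  ring

/-! ### Interpolation and the Besov bound -/

/-- Interpolation between `L¹` and `L^∞`. In the bound the summand `M` serves `p = ∞` and the other
one finite `p`, which makes it independent of `j` in a single formula. -/
theorem ofReal_mul_eLpNorm_le {n : ℕ} (g : Rn n → ℂ) (j : ℕ) {M N : ℝ≥0∞}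
    (hMtop : M ≠ ∞) (hM : ∀ x, ‖g x‖ₑ ≤ M) (hN : ENNReal.ofReal (2 ^ j) * ∫⁻ x, ‖g x‖ₑ ≤ N)
    {p : ℝ≥0∞} (hp : 1 ≤ p) :
    ENNReal.ofReal (2 ^ ((j : ℝ) * (1 / p).toReal)) * eLpNorm g p volume ≤
      M + (M ^ (p.toReal - 1) * N) ^ (1 / p.toReal) := by
  rcases eq_or_ne p ∞ with rfl | hp'
  · simp only [ENNReal.div_top, ENNReal.toReal_zero, mul_zero, Real.rpow_zero, ENNReal.ofReal_one,
      one_mul, eLpNorm_exponent_top]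
    exact (eLpNormEssSup_le_of_ae_enorm_bound (Filter.Eventually.of_forall hM)).trans
      le_self_add
  have hp1 : 1 ≤ p.toReal := by
    rw [← ENNReal.toReal_one]
    exact ENNReal.toReal_mono hp' hp
  refine le_trans ?_ le_add_self
  rw [eLpNorm_eq_lintegral_rpow_enorm_toReal (by positivity) hp', ENNReal.toReal_div,
    ENNReal.toReal_one, Real.rpow_mul zero_le_two, Real.rpow_natCast,
    ← ENNReal.ofReal_rpow_of_nonneg (by positivity) (by positivity),
    ← ENNReal.mul_rpow_of_nonneg _ _ (by positivity)]
  refine ENNReal.rpow_le_rpow ?_ (by positivity)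
  have h1 : ∫⁻ x, ‖g x‖ₑ ^ p.toReal ≤ M ^ (p.toReal - 1) * ∫⁻ x, ‖g x‖ₑ := by
    rw [← lintegral_const_mul' _ _ (ENNReal.rpow_ne_top_of_nonneg (by linarith) hMtop)]
    refine lintegral_mono fun x => ?_
    calc ‖g x‖ₑ ^ p.toReal = ‖g x‖ₑ ^ (p.toReal - 1) * ‖g x‖ₑ ^ (1 : ℝ) := by
          rw [← ENNReal.rpow_add_of_nonneg _ _ (by linarith) zero_le_one, sub_add_cancel]
      _ ≤ _ := by
          rw [ENNReal.rpow_one]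
          exact mul_le_mul_left (ENNReal.rpow_le_rpow (hM x) (by linarith)) _
  calc _ ≤ ENNReal.ofReal (2 ^ j) * (M ^ (p.toReal - 1) * ∫⁻ x, ‖g x‖ₑ) := by gcongr
    _ = M ^ (p.toReal - 1) * (ENNReal.ofReal (2 ^ j) * ∫⁻ x, ‖g x‖ₑ) := by ring
    _ ≤ _ := by gcongr

/-- The characteristic function of a set of finite measure whose translates by `y` differ from it
by a set of measure `O(|y|)` belongs to `B^{1/p}_{p,∞}`. -/
theorem setDistribution_mem_besovSpace {n : ℕ} {S : Set (Rn n)}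
    (hm : MeasurableSet S) (hS : volume S < ∞) {K : ℝ≥0∞} (hKtop : K ≠ ∞)
    (hK : ∀ y, volume {x | ¬(x ∈ S ↔ x - y ∈ S)} ≤ K * ‖y‖ₑ)
    {φ₀ φ : 𝓢(Rn n, ℂ)} (h : IsAdmissible φ₀ φ) {p : ℝ≥0∞} (hp : 1 ≤ p) :
    setDistribution S hS ∈ besovSpace φ₀ φ (1 / p).toReal p ∞ := by
  set M := (∫⁻ z, ‖φ₀ z‖ₑ) + ∫⁻ z, ‖φ z‖ₑ with hMdef
  set N := volume S * (∫⁻ z, ‖φ₀ z‖ₑ) + K * ∫⁻ z, ‖φ z‖ₑ * ‖z‖ₑ with hNdef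
  have hMtop : M < ∞ := ENNReal.add_lt_top.2 ⟨lintegral_enorm_lt_top φ₀, lintegral_enorm_lt_top φ⟩
  have hNtop : N < ∞ := ENNReal.add_lt_top.2 ⟨ENNReal.mul_lt_top hS (lintegral_enorm_lt_top φ₀),
    ENNReal.mul_lt_top hKtop.lt_top (lintegral_enorm_mul_enorm_lt_top φ)⟩
  have hbound : ∀ (ψ : 𝓢(Rn n, ℂ)) x,
      ‖conv ψ (setDistribution S hS) x‖ₑ ≤ ∫⁻ z, ‖ψ z‖ₑ := fun ψ x =>
    (enorm_conv_le hm hS ψ x).trans (lintegral_mono fun z => Set.indicator_le_self _ _ z)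
  have key : ∀ j : ℕ, ENNReal.ofReal (2 ^ ((j : ℝ) * (1 / p).toReal)) *
      eLpNorm (conv (resolution φ₀ φ j) (setDistribution S hS)) p volume ≤
      M + (M ^ (p.toReal - 1) * N) ^ (1 / p.toReal) := by
    intro j
    rcases eq_or_ne j 0 with rfl | hj
    · refine ofReal_mul_eLpNorm_le _ 0 hMtop.ne (fun x => (hbound _ x).trans ?_) ?_ hp
      · simp only [resolution, if_true]
        exact le_self_add
      · simp only [resolution, if_true, pow_zero, ENNReal.ofReal_one, one_mul]
        exact (lintegral_enorm_conv_le hm hS φ₀).trans le_self_add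
    · refine ofReal_mul_eLpNorm_le _ j hMtop.ne (fun x => (hbound _ x).trans ?_) ?_ hp
      · simp only [resolution, if_neg hj]
        rw [lintegral_enorm_dilate]
        exact le_add_self
      · simp only [resolution, if_neg hj]
        refine le_trans ?_ le_add_self
        rw [← lintegral_enorm_dilate_mul_enorm φ j, mul_left_comm]
        gcongr
        exact lintegral_enorm_conv_le_of_integral_eq_zero hm hS hK
          (integral_dilate_eq_zero h.integral_eq_zero j)
  change besovNorm _ _ _ _ _ _ < ∞
  rw [besovNorm, if_pos rfl]
  refine lt_of_le_of_lt (iSup_le key) (ENNReal.add_lt_top.2 ⟨hMtop, ?_⟩)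
  rcases eq_or_ne p ∞ with rfl | hp'
  -- Here `p.toReal = 0`, so the outer exponent `1 / 0` is `0` and the term equals `1`.
  · simp
  have hp1 : 1 ≤ p.toReal := by
    rw [← ENNReal.toReal_one]
    exact ENNReal.toReal_mono hp' hp
  exact ENNReal.rpow_lt_top_of_nonneg (by positivity) (ENNReal.mul_lt_top
    (ENNReal.rpow_lt_top_of_nonneg (by linarith) hMtop.ne) hNtop).ne

end SpiralBesov

end

theorem theorem4p18 :
    ∃ T : 𝓢'(SpiralBesov.Rn 2, ℂ),
      SpiralBesov.IsRegularDistribution T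
        (Set.indicator SpiralBesov.spiralDomain (fun _ => (1 : ℂ))) ∧
      ∀ φ₀ φ : 𝓢(SpiralBesov.Rn 2, ℂ), SpiralBesov.IsAdmissible φ₀ φ →
        ∀ p : ℝ≥0∞, 1 ≤ p →
          T ∈ SpiralBesov.besovSpace φ₀ φ (1 / p).toReal p ∞ := by
  have hS : volume (closure SpiralBesov.spiralDomain) < ∞ :=
    (measure_mono (closure_minimal SpiralBesov.spiralDomain_subset_closedBall
      Metric.isClosed_closedBall)).trans_lt measure_closedBall_lt_top
  -- The closure is used because it is plainly measurable; a null frontier makes it equal to the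
  -- domain almost everywhere and makes the domain null measurable.
  have hae : closure SpiralBesov.spiralDomain =ᵐ[volume] SpiralBesov.spiralDomain :=
    closure_ae_eq_of_null_frontier SpiralBesov.volume_frontier_spiralDomain
  have hnull : NullMeasurableSet SpiralBesov.spiralDomain volume :=
    nullMeasurableSet_of_null_frontier SpiralBesov.volume_frontier_spiralDomain
  refine ⟨SpiralBesov.setDistribution _ hS, fun ψ => ?_, fun φ₀ φ h p hp =>
    SpiralBesov.setDistribution_mem_besovSpace isClosed_closure.measurableSet hS
      (K := ENNReal.ofReal 36 * volume (Metric.ball (0 : SpiralBesov.Rn 2) 1))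
      (ENNReal.mul_ne_top ENNReal.ofReal_ne_top measure_ball_lt_top.ne) (fun y => ?_) h hp⟩
  · have heq : (fun x => SpiralBesov.spiralDomain.indicator (fun _ => (1 : ℂ)) x * ψ x) =
        SpiralBesov.spiralDomain.indicator ψ := by
      ext x
      by_cases hx : x ∈ SpiralBesov.spiralDomain <;> simp [hx]
    rw [heq]
    refine ⟨ψ.integrable.indicator₀ hnull, ?_⟩
    rw [SpiralBesov.setDistribution_apply, integral_indicator₀ hnull]
    exact setIntegral_congr_set hae
  · refine (SpiralBesov.volume_translate_le y).trans (le_of_eq ?_)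
    rw [ENNReal.ofReal_mul (by norm_num), ofReal_norm]
    ring
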